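/- Let $N\ge 1$, let $b\in\mathbb{Z}_{\ge 0}^N$ be a multi-index, and let $\mathfrak{G}$ be a finite set of pairs $(a,s)$ with $a\in\mathbb{Z}_{\ge 0}^N$ a multi-index and $s\in[0,+\infty)$. Suppose that $$I(r)=\int_{(0,1]^N}\frac{x^{b}\,dx}{\sum_{(a,s)\in\mathfrak{G}}x^{a}r^{s}}<+\infty\qquad\text{for all }0<r<1$$ (for $\mathfrak{G}=\varnothing$ the integral is $+\infty$). For $(a,s)\in\mathfrak{G}$ put $$P_{a,s}=\{y\in[0,+\infty)^N : \langle a-a',y\rangle-(s'-s)\le 0\ \text{ for all }(a',s')\in\mathfrak{G}\},\qquad \phi_a(y)=\langle a-b-\mathbf{1},y\rangle,$$ where $\mathbf{1}=(1,\dots,1)$, and let $\mathfrak{G}^\circ$ be the set of all $(a,s)\in\mathfrak{G}$ for which $P_{a,s}$ has positive $N$-dimensional volume. Then for every $(a,s)\in\mathfrak{G}^\circ$ the maximum $m_{a,s}=\max_{y\in P_{a,s}}\phi_a(y)$ exists. Let $d_{a,s}$ be the dimension (of the affine hull) of the face $M_{a,s}=\{y\in P_{a,s}:\phi_a(y)=m_{a,s}\}$.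 Then $\mathfrak{G}^\circ\neq\varnothing$, and with $$\alpha_0=\max\{s+m_{a,s} : (a,s)\in\mathfrak{G}^\circ\},\qquad d_0=\max\{d_{a,s} : (a,s)\in\mathfrak{G}^\circ,\ s+m_{a,s}=\alpha_0\}$$ one has $$I(r)\approx\sum_{(a,s)\in\mathfrak{G}^\circ}r^{-s-m_{a,s}}|\ln r|^{d_{a,s}}\approx r^{-\alpha_0}|\ln r|^{d_0}\qquad\text{as }r\to0^+.$$ Here $f(r)\approx g(r)$ as $r\to 0^+$ means that there are constants $C,\delta>0$ with $C^{-1}g(r)\le f(r)\le C\,g(r)$ for all $0<r<\delta$. Furthermore, if $s$ is a non-negative integer for every $(a,s)\in\mathfrak{G}$, then $\alpha_0\in\mathbb{Q}$. -/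

import Mathlib

namespace MonomialIntegral

/-- The monomial `x ^ a = x₁ ^ a₁ ⋯ x_N ^ a_N` of a multi-index `a`. -/
def monomial {N : ℕ} (a : Fin N → ℕ) (x : Fin N → ℝ) : ℝ :=
  ∏ i, x i ^ a i

/-- The half-open unit cube `(0,1]^N`. -/
def cube (N : ℕ) : Set (Fin N → ℝ) :=
  {x | ∀ i, x i ∈ Set.Ioc (0 : ℝ) 1}

/-- `I(r) = ∫_{(0,1]^N} x^b dx / ∑_{(a,s) ∈ G} x^a r^s`, a Lebesgue integral with values in
`[0,∞]`. The numerator is positive on the cube, and so is the denominator if `G` is nonempty and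
`0 < r`. For empty `G` the quotient is `∞`. -/
noncomputable def I {N : ℕ} (G : Finset ((Fin N → ℕ) × ℝ)) (b : Fin N → ℕ) (r : ℝ) : ENNReal :=
  ∫⁻ x in cube N,
    ENNReal.ofReal (monomial b x) / ENNReal.ofReal (∑ p ∈ G, monomial p.1 x * r ^ p.2)

/-- The polyhedron `P_{a,s}` of all `y ∈ [0,∞)^N` with `⟨a - a', y⟩ - (s' - s) ≤ 0` for all
`(a',s') ∈ G`. -/
def P {N : ℕ} (G : Finset ((Fin N → ℕ) × ℝ)) (p : (Fin N → ℕ) × ℝ) : Set (Fin N → ℝ) :=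
  {y | (∀ i, 0 ≤ y i) ∧
    ∀ p' ∈ G, ∑ i, ((p.1 i : ℝ) - (p'.1 i : ℝ)) * y i - (p'.2 - p.2) ≤ 0}

/-- The linear functional `φ_a(y) = ⟨a - b - 𝟏, y⟩`. -/
def phi {N : ℕ} (b a : Fin N → ℕ) (y : Fin N → ℝ) : ℝ :=
  ∑ i, ((a i : ℝ) - (b i : ℝ) - 1) * y i

open Classical in
/-- The set `G°` of the pairs in `G` whose polyhedron has positive `N`-dimensional volume. -/
noncomputable def Gcirc {N : ℕ} (G : Finset ((Fin N → ℕ) × ℝ)) : Finset ((Fin N → ℕ) × ℝ) :=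
  G.filter (fun p => 0 < MeasureTheory.volume (P G p))

/-- The maximum `m_{a,s}` of `φ_a` over `P_{a,s}`, as a supremum. -/
noncomputable def m {N : ℕ} (G : Finset ((Fin N → ℕ) × ℝ)) (b : Fin N → ℕ)
    (p : (Fin N → ℕ) × ℝ) : ℝ :=
  sSup (phi b p.1 '' P G p)

/-- The set `M_{a,s}` of the points of `P_{a,s}` where `φ_a` takes the value `m_{a,s}`. -/
noncomputable def M {N : ℕ} (G : Finset ((Fin N → ℕ) × ℝ)) (b : Fin N → ℕ)
    (p : (Fin N → ℕ) × ℝ) : Set (Fin N → ℝ) :=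
  {y | y ∈ P G p ∧ phi b p.1 y = m G b p}

/-- The dimension `d_{a,s}` of `M_{a,s}`, that is, the dimension of its affine hull. -/
noncomputable def d {N : ℕ} (G : Finset ((Fin N → ℕ) × ℝ)) (b : Fin N → ℕ)
    (p : (Fin N → ℕ) × ℝ) : ℕ :=
  Module.finrank ℝ (affineSpan ℝ (M G b p)).direction

/-- `f(r) ≈ g(r)` as `r → 0⁺`: the functions are comparable up to a constant on some `(0,δ)`. -/
def Comparable (f g : ℝ → ℝ) : Prop :=
  ∃ C : ℝ, 0 < C ∧ ∃ δ : ℝ, 0 < δ ∧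
    ∀ r : ℝ, 0 < r → r < δ → C⁻¹ * g r ≤ f r ∧ f r ≤ C * g r

end MonomialIntegral

/-!
The substitution `x = exp (-L y)` with `L = |log r|` turns `I(r)` into `L ^ N` times the integral
over the orthant of the reciprocal of `∑ exp (-L (φ_a(y) + s))`. On the polyhedron `P_{a,s}` the
summand of `(a,s)` is the largest, so up to a factor `card G` the integrand is
`exp (L (φ_a(y) + s))` there (`I_exp_neg`, `I_le_sum_contribution`, `contribution_le`). As the
polyhedra cover the orthant, `I(r)` is comparable to the sum of the contributions
`exp (L s) L ^ N ∫_{P_{a,s}} exp (L φ_a)` of the polyhedra of positive volume.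

Let `Q` be a polyhedron with nonempty interior on which `exp φ` is integrable. The superlevel sets
of `φ` on `Q` are convex sets of finite volume with nonempty interior, hence bounded
(`Convex.isBounded_of_measure_lt_top`); thus `φ` attains a maximum `m` on `Q`. Let `F` be the
maximal face, `y₀` a relative interior point of `F`, `W` the direction of `F`, of dimension `d`, and
`W'` a complement of `W`. Near `y₀` the polyhedron is the translate of a cone that is invariant under
`W`, and compactness of the unit sphere gives `δ ‖w'‖ ≤ m - φ y` for the component `w'` of `y - y₀`
along `W'` (`exists_mul_norm_projection_le`). Now substitute `y = y₀ + w + w' / L`: since `φ`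
vanishes on `W`, the integral of `exp (L φ)` becomes `exp (L m) L ^ (d - N)` times the integral of
`exp φ` over a rescaled domain. For all `L ≥ 1` the rescaled domains contain one fixed set of
positive measure, and on them `φ z ≤ 1 - ‖z‖ / K`, so these integrals lie between two positive
constants (`exists_laplace_bounds`). Hence the contribution of `P_{a,s}` is of the order
`exp (L (s + m)) L ^ d`, and the sum is governed by its lexicographically largest pair `(s + m, d)`.

For rational data, a `ℚ`-linear retraction of `ℝ` onto `ℚ` applied to the coordinates of `y₀` gives a
rational point of the affine hull of `F`, where `φ` still has the value `m`; so `m` is rational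
(`exists_rat_eq_of_isMax`).
-/

open MeasureTheory Set Metric

/-! ### Convex sets of finite volume -/

section Convex

variable {E : Type*} [NormedAddCommGroup E] [NormedSpace ℝ E] [MeasurableSpace E]
  [BorelSpace E] {μ : Measure E} [μ.IsAddHaarMeasure]

/-- A convex set of finite volume with nonempty interior is bounded: along a segment of length `R`
from the centre of a ball of radius `ρ` in the set, one finds about `R / (2 ρ)` disjoint balls of
radius `ρ / 2` in the set. -/
theorem Convex.isBounded_of_measure_lt_top {s : Set E} (hs : Convex ℝ s)
    (hint : (interior s).Nonempty) (hμ : μ s < ⊤) : Bornology.IsBounded s := by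
  obtain ⟨y₀, hy₀⟩ := hint
  obtain ⟨ρ, hρ, hball⟩ := Metric.isOpen_iff.1 isOpen_interior y₀ hy₀
  replace hball : ball y₀ ρ ⊆ s := hball.trans interior_subset
  by_contra hb
  have hfar : ∀ R : ℝ, ∃ z ∈ s, R < ‖z - y₀‖ := by
    intro R
    by_contra! h
    exact hb ((isBounded_closedBall (x := y₀) (r := R)).subset fun z hz => by
      simpa [dist_eq_norm] using h z hz)
  set β := μ (ball (0 : E) (ρ / 2)) with hβ
  have hβ0 : β ≠ 0 := (measure_ball_pos μ _ (by positivity)).ne'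
  have hpack : ∀ n : ℕ, n * β ≤ μ s := by
    intro n
    obtain ⟨z, hz, hzR⟩ := hfar (2 * n * ρ)
    have hD : 0 < ‖z - y₀‖ := lt_of_le_of_lt (by positivity) hzR
    set D := ‖z - y₀‖ with hDdef
    -- The centres stay in the half of the segment next to `y₀`, where the convex hull of the ball
    -- and `z` still contains balls of radius `ρ / 2`.
    let w : ℕ → E := fun k => y₀ + (k * ρ / D) • (z - y₀)
    have hsub : ∀ k ∈ Finset.range n, ball (w k) (ρ / 2) ⊆ s := by
      intro k hk u hu
      have hkn : (k : ℝ) ≤ n := by exact_mod_cast (Finset.mem_range.1 hk).le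
      have ht0 : 0 ≤ k * ρ / D := by positivity
      have ht : k * ρ / D ≤ 1 / 2 := by
        rw [div_le_div_iff₀ hD two_pos]
        nlinarith
      set t := k * ρ / D with htdef
      have h1t : 0 < 1 - t := by linarith
      have hu' : ‖u - w k‖ < ρ / 2 := by simpa [dist_eq_norm] using hu
      have hmem : y₀ + (1 - t)⁻¹ • (u - w k) ∈ s := by
        apply hball
        rw [mem_ball, dist_eq_norm, add_sub_cancel_left, norm_smul, norm_inv, Real.norm_eq_abs,
          abs_of_pos h1t, inv_mul_lt_iff₀ h1t]
        nlinarith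
      have := hs hmem hz h1t.le ht0 (by ring)
      convert this using 1
      rw [smul_add, smul_smul, mul_inv_cancel₀ h1t.ne', one_smul]
      simp only [w, ← htdef]
      module
    have hdisj : (Finset.range n : Set ℕ).PairwiseDisjoint fun k => ball (w k) (ρ / 2) := by
      intro k _ l _ hkl
      apply ball_disjoint_ball
      have h1 : (1 : ℝ) ≤ |(k : ℝ) - l| := by
        have : (1 : ℤ) ≤ |(k : ℤ) - l| := Int.one_le_abs (sub_ne_zero.2 (by exact_mod_cast hkl))
        exact_mod_cast this
      have h2 : w k - w l = (((k : ℝ) - l) * ρ / D) • (z - y₀) := by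
        simp only [w]
        module
      rw [dist_eq_norm, h2, norm_smul, ← hDdef, Real.norm_eq_abs, abs_div, abs_mul,
        abs_of_pos hρ, abs_of_pos hD, div_mul_cancel₀ _ hD.ne']
      nlinarith
    calc n * β = ∑ k ∈ Finset.range n, μ (ball (w k) (ρ / 2)) := by
          simp [hβ, Measure.addHaar_ball_center]
      _ = μ (⋃ k ∈ Finset.range n, ball (w k) (ρ / 2)) :=
          (measure_biUnion_finset hdisj fun _ _ => measurableSet_ball).symm
      _ ≤ μ s := measure_mono (iUnion₂_subset hsub)
  have htop : μ s = ⊤ := by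
    refine top_unique (ENNReal.le_of_forall_nnreal_lt fun r _ => ?_)
    obtain ⟨n, hn⟩ := ENNReal.exists_nat_mul_gt hβ0 (ENNReal.coe_ne_top (r := r))
    exact hn.le.trans (hpack n)
  exact hμ.ne htop

variable [FiniteDimensional ℝ E]

theorem Convex.interior_nonempty_of_measure_pos {s : Set E} (hs : Convex ℝ s) (hμ : 0 < μ s) :
    (interior s).Nonempty := by
  by_contra h
  rw [not_nonempty_iff_eq_empty] at h
  have hle : μ s ≤ μ (interior s) + μ (frontier s) :=
    (measure_mono (subset_closure.trans (closure_eq_interior_union_frontier s).subset)).trans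
      (measure_union_le _ _)
  rw [h, hs.addHaar_frontier μ, measure_empty, zero_add] at hle
  exact hμ.not_ge hle

/-- If `exp ∘ φ` is integrable over a closed convex set, the superlevel sets of `φ` on it are
bounded, since they have finite volume. -/
theorem Convex.isBounded_superlevel {Q : Set E} (hQ : Convex ℝ Q) (hint : (interior Q).Nonempty)
    (φ : E →ₗ[ℝ] ℝ) (hfin : ∫⁻ y in Q, ENNReal.ofReal (Real.exp (φ y)) ∂μ < ⊤) (c : ℝ) :
    Bornology.IsBounded (Q ∩ {y | c ≤ φ y}) := by
  have hφ : Continuous φ := φ.continuous_of_finiteDimensional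
  obtain ⟨y₀, hy₀⟩ := hint
  set c' := min c (φ y₀ - 1) with hc'
  suffices h : Bornology.IsBounded (Q ∩ {y | c' ≤ φ y}) from
    h.subset fun y hy => ⟨hy.1, le_trans (min_le_left c (φ y₀ - 1)) hy.2.out⟩
  have hmeas : MeasurableSet {y | c' ≤ φ y} := (isClosed_le continuous_const hφ).measurableSet
  refine Convex.isBounded_of_measure_lt_top (μ := μ)
    (hQ.inter (convex_halfSpace_ge φ.isLinear c')) ⟨y₀, ?_⟩ ?_
  · rw [interior_inter]
    refine ⟨hy₀, mem_interior.2 ⟨{y | c' < φ y}, fun y hy => le_of_lt (Set.mem_ofPred.1 hy),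
      isOpen_lt continuous_const hφ, ?_⟩⟩
    have := min_le_right c (φ y₀ - 1)
    show c' < φ y₀
    linarith
  · have hle : ENNReal.ofReal (Real.exp c') * μ (Q ∩ {y | c' ≤ φ y})
        ≤ ∫⁻ y in Q, ENNReal.ofReal (Real.exp (φ y)) ∂μ := by
      rw [inter_comm, ← Measure.restrict_apply hmeas]
      refine le_trans ?_ (mul_meas_ge_le_lintegral₀ (by fun_prop) (ENNReal.ofReal (Real.exp c')))
      gcongr
      exact fun h => ENNReal.ofReal_le_ofReal (Real.exp_le_exp.2 h)
    have hpos : ENNReal.ofReal (Real.exp c') ≠ 0 := by simp [Real.exp_pos]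
    exact (ENNReal.mul_lt_top_iff.1 (hle.trans_lt hfin)).elim (·.2) (fun h => by
      rcases h with h | h
      · exact absurd h hpos
      · simp [h])

theorem Convex.exists_isMaxOn_of_lintegral_exp {Q : Set E} (hQ : Convex ℝ Q) (hcl : IsClosed Q)
    (hint : (interior Q).Nonempty) (φ : E →ₗ[ℝ] ℝ)
    (hfin : ∫⁻ y in Q, ENNReal.ofReal (Real.exp (φ y)) ∂μ < ⊤) :
    ∃ y ∈ Q, ∀ z ∈ Q, φ z ≤ φ y := by
  have hφ : Continuous φ := φ.continuous_of_finiteDimensional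
  obtain ⟨y₀, hy₀⟩ := hint
  have hK : IsCompact (Q ∩ {y | φ y₀ ≤ φ y}) :=
    Metric.isCompact_of_isClosed_isBounded (hcl.inter (isClosed_le continuous_const hφ))
      (hQ.isBounded_superlevel ⟨y₀, hy₀⟩ φ hfin _)
  obtain ⟨y, hy, hmax⟩ := hK.exists_isMaxOn ⟨y₀, interior_subset hy₀, le_refl (φ y₀)⟩ hφ.continuousOn
  refine ⟨y, hy.1, fun z hz => ?_⟩
  rcases le_total (φ y₀) (φ z) with h | h
  · exact hmax ⟨hz, h⟩
  · exact h.trans hy.2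

/-- Integrability of `exp (-c ‖x‖)`, by comparison with a negative power of `1 + ‖x‖`. -/
theorem lintegral_exp_neg_mul_norm_lt_top {c : ℝ} (hc : 0 < c) :
    ∫⁻ x : E, ENNReal.ofReal (Real.exp (-(c * ‖x‖))) ∂μ < ⊤ := by
  set n := Module.finrank ℝ E
  have hJ := finite_integral_one_add_norm (E := E) (μ := μ) (r := (n + 1 : ℕ)) (by simp [n])
  set K : ℝ := (n + 1).factorial * Real.exp c / c ^ (n + 1) with hK
  have hK0 : 0 ≤ K := by positivity
  refine lt_of_le_of_lt (b := ENNReal.ofReal K *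
    ∫⁻ x : E, ENNReal.ofReal ((1 + ‖x‖) ^ (-((n + 1 : ℕ) : ℝ))) ∂μ) ?_
    (ENNReal.mul_lt_top ENNReal.ofReal_lt_top hJ)
  rw [← lintegral_const_mul' _ _ ENNReal.ofReal_ne_top]
  refine lintegral_mono fun x => ?_
  rw [← ENNReal.ofReal_mul hK0]
  apply ENNReal.ofReal_le_ofReal
  have h1 : 0 < 1 + ‖x‖ := by positivity
  have h2 := Real.pow_div_factorial_le_exp (c * (1 + ‖x‖)) (by positivity) (n + 1)
  rw [Real.rpow_neg h1.le, Real.rpow_natCast, ← div_eq_mul_inv, le_div_iff₀ (by positivity), hK,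
    le_div_iff₀ (by positivity)]
  rw [div_le_iff₀ (by positivity), mul_pow] at h2
  calc Real.exp (-(c * ‖x‖)) * (1 + ‖x‖) ^ (n + 1) * c ^ (n + 1)
      = Real.exp (-(c * ‖x‖)) * (c ^ (n + 1) * (1 + ‖x‖) ^ (n + 1)) := by ring
    _ ≤ Real.exp (-(c * ‖x‖)) * (Real.exp (c * (1 + ‖x‖)) * (n + 1).factorial) := by gcongr
    _ = (n + 1).factorial * Real.exp c := by
      rw [← mul_assoc, ← Real.exp_add, mul_comm]
      ring_nf

end Convex

/-! ### Polyhedra, faces and tangent cones -/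

section Polyhedron

variable {ι E : Type*} [NormedAddCommGroup E] [NormedSpace ℝ E]

/-- The polyhedron of the points `y` with `ℓ j y ≤ c j` for all `j`. -/
def polyhedron (ℓ : ι → E →ₗ[ℝ] ℝ) (c : ι → ℝ) : Set E :=
  {y | ∀ j, ℓ j y ≤ c j}

/-- The part of the polyhedron on which `φ` takes the value `m`; it is a face if `m` is the maximum
of `φ`. -/
def levelFace (ℓ : ι → E →ₗ[ℝ] ℝ) (c : ι → ℝ) (φ : E →ₗ[ℝ] ℝ) (m : ℝ) : Set E :=
  {y | y ∈ polyhedron ℓ c ∧ φ y = m}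

/-- The cone of the vectors along which no constraint that is tight on all of `F` increases. For a
face `F` of the polyhedron, it is the tangent cone at the relative interior points of `F`. -/
def tangentConeAlong (ℓ : ι → E →ₗ[ℝ] ℝ) (c : ι → ℝ) (F : Set E) : Set E :=
  {v | ∀ j, (∀ y ∈ F, ℓ j y = c j) → ℓ j v ≤ 0}

variable {ℓ : ι → E →ₗ[ℝ] ℝ} {c : ι → ℝ} {φ : E →ₗ[ℝ] ℝ} {m : ℝ}

theorem convex_polyhedron : Convex ℝ (polyhedron ℓ c) := by
  intro x hx y hy a b ha hb hab j
  have h1 := hx j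
  have h2 := hy j
  rw [map_add, map_smul, map_smul, smul_eq_mul, smul_eq_mul]
  calc a * ℓ j x + b * ℓ j y ≤ a * c j + b * c j := by gcongr
    _ = c j := by rw [← add_mul, hab, one_mul]

theorem isClosed_polyhedron [FiniteDimensional ℝ E] : IsClosed (polyhedron ℓ c) := by
  have : polyhedron ℓ c = ⋂ j, {y | ℓ j y ≤ c j} := by
    ext y
    simp [polyhedron]
  rw [this]
  exact isClosed_iInter fun j =>
    isClosed_le (ℓ j).continuous_of_finiteDimensional continuous_const

theorem isClosed_tangentConeAlong [FiniteDimensional ℝ E] {F : Set E} :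
    IsClosed (tangentConeAlong ℓ c F) := by
  have : tangentConeAlong ℓ c F = ⋂ j, ⋂ _ : ∀ y ∈ F, ℓ j y = c j, {v | ℓ j v ≤ 0} := by
    ext y
    simp [tangentConeAlong]
  rw [this]
  exact isClosed_iInter fun j => isClosed_iInter fun _ =>
    isClosed_le (ℓ j).continuous_of_finiteDimensional continuous_const

theorem smul_mem_tangentConeAlong {F : Set E} {v : E} (hv : v ∈ tangentConeAlong ℓ c F) {t : ℝ}
    (ht : 0 ≤ t) : t • v ∈ tangentConeAlong ℓ c F := by
  intro j hj
  rw [map_smul, smul_eq_mul]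
  exact mul_nonpos_of_nonneg_of_nonpos ht (hv j hj)

theorem sub_mem_tangentConeAlong {F : Set E} {x y : E} (hx : x ∈ F) (hy : y ∈ polyhedron ℓ c) :
    y - x ∈ tangentConeAlong ℓ c F := by
  intro j hj
  rw [map_sub, hj x hx]
  exact sub_nonpos.2 (hy j)

theorem map_eq_zero_of_mem_vectorSpan {F : Set E} {f : E →ₗ[ℝ] ℝ} {a : ℝ} (hf : ∀ y ∈ F, f y = a)
    {w : E} (hw : w ∈ vectorSpan ℝ F) : f w = 0 := by
  suffices vectorSpan ℝ F ≤ LinearMap.ker f from this hw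
  rw [vectorSpan_def, Submodule.span_le]
  rintro _ ⟨x, hx, y, hy, rfl⟩
  simp [hf x hx, hf y hy]

theorem add_mem_tangentConeAlong_iff {F : Set E} {v w : E} (hw : w ∈ vectorSpan ℝ F) :
    w + v ∈ tangentConeAlong ℓ c F ↔ v ∈ tangentConeAlong ℓ c F := by
  refine forall_congr' fun j => forall_congr' fun hj => ?_
  rw [map_add, map_eq_zero_of_mem_vectorSpan hj hw, zero_add]

/-- A nonempty face has a relative interior point, at which only those constraints are tight that
are tight on the whole face. -/
theorem exists_strict_mem_levelFace [Finite ι] (hne : (levelFace ℓ c φ m).Nonempty) :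
    ∃ y ∈ levelFace ℓ c φ m, ∀ j, (¬ ∀ z ∈ levelFace ℓ c φ m, ℓ j z = c j) → ℓ j y < c j := by
  classical
  have := Fintype.ofFinite ι
  suffices h : ∀ s : Finset ι, ∃ y ∈ levelFace ℓ c φ m, ∀ j ∈ s,
      (¬ ∀ z ∈ levelFace ℓ c φ m, ℓ j z = c j) → ℓ j y < c j by
    obtain ⟨y, hy, h⟩ := h Finset.univ
    exact ⟨y, hy, fun j => h j (Finset.mem_univ j)⟩
  intro s
  induction s using Finset.induction_on with
  | empty =>
    obtain ⟨y, hy⟩ := hne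
    exact ⟨y, hy, by simp⟩
  | insert k s _ ih =>
    obtain ⟨y, hy, hys⟩ := ih
    by_cases hk : ∀ z ∈ levelFace ℓ c φ m, ℓ k z = c k
    · refine ⟨y, hy, fun j hj hn => ?_⟩
      rcases Finset.mem_insert.1 hj with rfl | hj
      · exact absurd hk hn
      · exact hys j hj hn
    · push Not at hk
      obtain ⟨z, hz, hzk⟩ := hk
      have hmid : ∀ f : E →ₗ[ℝ] ℝ, f ((1 / 2 : ℝ) • y + (1 / 2 : ℝ) • z) = (f y + f z) / 2 := by
        intro f
        simp only [map_add, map_smul, smul_eq_mul]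
        ring
      refine ⟨(1 / 2 : ℝ) • y + (1 / 2 : ℝ) • z,
        ⟨convex_polyhedron hy.1 hz.1 (by norm_num) (by norm_num) (by norm_num), ?_⟩,
        fun j hj hn => ?_⟩
      · rw [hmid, hy.2, hz.2]
        ring
      · rw [hmid]
        have h1 := hy.1 j
        have h2 := hz.1 j
        rcases Finset.mem_insert.1 hj with rfl | hj
        · have := lt_of_le_of_ne h2 hzk
          linarith
        · have := hys j hj hn
          linarith

variable [FiniteDimensional ℝ E] [Finite ι] {y₀ : E}

/-- Near a relative interior point of a face, the polyhedron coincides with its tangent cone. -/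
theorem exists_add_mem_polyhedron_iff (hy₀ : y₀ ∈ levelFace ℓ c φ m)
    (hstrict : ∀ j, (¬ ∀ z ∈ levelFace ℓ c φ m, ℓ j z = c j) → ℓ j y₀ < c j) :
    ∃ ρ > 0, ∀ v, ‖v‖ < ρ →
      v ∈ tangentConeAlong ℓ c (levelFace ℓ c φ m) → y₀ + v ∈ polyhedron ℓ c := by
  have hev : ∀ᶠ v in nhds (0 : E), ∀ j, (¬ ∀ z ∈ levelFace ℓ c φ m, ℓ j z = c j) →
      ℓ j (y₀ + v) < c j := by
    rw [Filter.eventually_all]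
    intro j
    by_cases hj : ∀ z ∈ levelFace ℓ c φ m, ℓ j z = c j
    · exact Filter.Eventually.of_forall fun v h => absurd hj h
    · have hc : Continuous fun v => ℓ j (y₀ + v) :=
        (ℓ j).continuous_of_finiteDimensional.comp (continuous_const.add continuous_id)
      have : ∀ᶠ v in nhds (0 : E), ℓ j (y₀ + v) < c j :=
        hc.continuousAt.eventually_lt continuousAt_const (by simpa using hstrict j hj)
      exact this.mono fun v hv _ => hv
  obtain ⟨ρ, hρ, h⟩ := Metric.eventually_nhds_iff.1 hev
  refine ⟨ρ, hρ, fun v hv hT j => ?_⟩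
  by_cases hj : ∀ z ∈ levelFace ℓ c φ m, ℓ j z = c j
  · rw [map_add, hj y₀ hy₀]
    have := hT j hj
    linarith
  · exact (h (by simpa using hv) j hj).le

theorem exists_pos_add_smul_mem_polyhedron (hy₀ : y₀ ∈ levelFace ℓ c φ m)
    (hstrict : ∀ j, (¬ ∀ z ∈ levelFace ℓ c φ m, ℓ j z = c j) → ℓ j y₀ < c j) {v : E}
    (hv : v ∈ tangentConeAlong ℓ c (levelFace ℓ c φ m)) :
    ∃ t : ℝ, 0 < t ∧ y₀ + t • v ∈ polyhedron ℓ c := by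
  obtain ⟨ρ, hρ, h⟩ := exists_add_mem_polyhedron_iff hy₀ hstrict
  have hpos : 0 < ‖v‖ + 1 := by positivity
  have ht : 0 < ρ / (‖v‖ + 1) := by positivity
  refine ⟨ρ / (‖v‖ + 1), ht, h _ ?_ (smul_mem_tangentConeAlong hv ht.le)⟩
  rw [norm_smul, Real.norm_eq_abs, abs_of_pos ht, div_mul_eq_mul_div, div_lt_iff₀ hpos]
  nlinarith

theorem map_nonpos_of_mem_tangentConeAlong (hy₀ : y₀ ∈ levelFace ℓ c φ m)
    (hstrict : ∀ j, (¬ ∀ z ∈ levelFace ℓ c φ m, ℓ j z = c j) → ℓ j y₀ < c j)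
    (hmax : ∀ z ∈ polyhedron ℓ c, φ z ≤ m) {v : E}
    (hv : v ∈ tangentConeAlong ℓ c (levelFace ℓ c φ m)) : φ v ≤ 0 := by
  obtain ⟨t, ht, hmem⟩ := exists_pos_add_smul_mem_polyhedron hy₀ hstrict hv
  have := hmax _ hmem
  rw [map_add, map_smul, smul_eq_mul, hy₀.2] at this
  exact nonpos_of_mul_nonpos_right (by linarith) ht

/-- A tangent vector that does not decrease `φ` is parallel to the face. -/
theorem mem_vectorSpan_of_map_eq_zero (hy₀ : y₀ ∈ levelFace ℓ c φ m)
    (hstrict : ∀ j, (¬ ∀ z ∈ levelFace ℓ c φ m, ℓ j z = c j) → ℓ j y₀ < c j) {v : E}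
    (hv : v ∈ tangentConeAlong ℓ c (levelFace ℓ c φ m)) (hφ : φ v = 0) :
    v ∈ vectorSpan ℝ (levelFace ℓ c φ m) := by
  obtain ⟨t, ht, hmem⟩ := exists_pos_add_smul_mem_polyhedron hy₀ hstrict hv
  have h1 : y₀ + t • v ∈ levelFace ℓ c φ m := ⟨hmem, by simp [hφ, hy₀.2]⟩
  have h2 := vsub_mem_vectorSpan ℝ h1 hy₀
  rw [vsub_eq_sub, add_sub_cancel_left] at h2
  exact (Submodule.smul_mem_iff _ ht.ne').1 h2

/-- Sharpness of a linear program: transversally to the maximal face, `φ` decreases at least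
linearly, by compactness of the unit sphere. -/
theorem exists_mul_norm_projection_le (hy₀ : y₀ ∈ levelFace ℓ c φ m)
    (hstrict : ∀ j, (¬ ∀ z ∈ levelFace ℓ c φ m, ℓ j z = c j) → ℓ j y₀ < c j)
    (hmax : ∀ z ∈ polyhedron ℓ c, φ z ≤ m) {W' : Submodule ℝ E}
    (hW : IsCompl (vectorSpan ℝ (levelFace ℓ c φ m)) W') :
    ∃ δ > 0, ∀ v ∈ tangentConeAlong ℓ c (levelFace ℓ c φ m),
      δ * ‖W'.projection _ hW.symm v‖ ≤ - φ v := by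
  set F := levelFace ℓ c φ m
  set T := tangentConeAlong ℓ c F
  have hφc : Continuous φ := φ.continuous_of_finiteDimensional
  obtain ⟨δ, hδ, hK⟩ : ∃ δ > 0, ∀ v ∈ T ∩ (W' ∩ sphere (0 : E) 1), δ ≤ - φ v := by
    have hcomp : IsCompact (T ∩ (W' ∩ sphere (0 : E) 1)) :=
      ((isCompact_sphere _ _).inter_left W'.closed_of_finiteDimensional).inter_left
        isClosed_tangentConeAlong
    rcases (T ∩ (W' ∩ sphere (0 : E) 1)).eq_empty_or_nonempty with h | h
    · exact ⟨1, one_pos, by simp [h]⟩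
    obtain ⟨v, hv, hvmax⟩ := hcomp.exists_isMaxOn h hφc.continuousOn
    refine ⟨- φ v, ?_, fun u hu => neg_le_neg (hvmax hu)⟩
    have hle := map_nonpos_of_mem_tangentConeAlong hy₀ hstrict hmax hv.1
    rcases hle.lt_or_eq with hlt | h0
    · linarith
    -- The only tangent vectors with `φ v = 0` lie in the span of the face, which meets `W'` in `0`.
    · exfalso
      have hvW := mem_vectorSpan_of_map_eq_zero hy₀ hstrict hv.1 h0
      have hv0 : v = 0 := (Submodule.disjoint_def.1 hW.disjoint) v hvW hv.2.1
      have := hv.2.2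
      simp [hv0] at this
  refine ⟨δ, hδ, fun v hv => ?_⟩
  set w := (vectorSpan ℝ F).projection W' hW v with hw
  set w' := W'.projection _ hW.symm v with hw'
  have hsum : w + w' = v := Submodule.projection_add_projection_eq_self hW v
  have hwW : w ∈ vectorSpan ℝ F := Submodule.projection_apply_mem _ _
  have hw'T : w' ∈ T := by
    rw [← hsum] at hv
    exact (add_mem_tangentConeAlong_iff hwW).1 hv
  have hφv : φ v = φ w' := by
    rw [← hsum, map_add, map_eq_zero_of_mem_vectorSpan (fun y hy => hy.2) hwW, zero_add]
  rw [hφv]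
  rcases eq_or_ne w' 0 with h0 | h0
  · simp [h0]
  have hn : 0 < ‖w'‖ := norm_pos_iff.2 h0
  have := hK (‖w'‖⁻¹ • w') ⟨smul_mem_tangentConeAlong hw'T (by positivity),
    W'.smul_mem _ (Submodule.projection_apply_mem _ _), by
      simp [norm_smul, hn.ne']⟩
  rw [map_smul, smul_eq_mul, ← mul_neg, ← div_eq_inv_mul, le_div_iff₀ hn] at this
  exact this

end Polyhedron

/-! ### Anisotropic dilations -/

section Dilation

variable {E : Type*} [AddCommGroup E] [Module ℝ E] {W W' : Submodule ℝ E}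

/-- The linear map that is the identity on `W` and multiplication by `t` on the complement `W'`. -/
noncomputable def transverseDilation (h : IsCompl W W') (t : ℝ) : E →ₗ[ℝ] E :=
  W.projection W' h + t • W'.projection W h.symm

theorem det_transverseDilation [FiniteDimensional ℝ E] (h : IsCompl W W') (t : ℝ) :
    LinearMap.det (transverseDilation h t) = t ^ Module.finrank ℝ W' := by
  have : transverseDilation h t = ((Submodule.prodEquivOfIsCompl W W' h : W × W' →ₗ[ℝ] E) ∘ₗ
      LinearMap.prodMap LinearMap.id (t • LinearMap.id) ∘ₗ
      ((Submodule.prodEquivOfIsCompl W W' h).symm : E →ₗ[ℝ] W × W')) := by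
    ext x
    simp [transverseDilation]
  rw [this, LinearMap.det_conj, LinearMap.det_prodMap]
  simp

theorem transverseDilation_comp (h : IsCompl W W') (s t : ℝ) (x : E) :
    transverseDilation h s (transverseDilation h t x) = transverseDilation h (s * t) x := by
  have h1 := Submodule.projection_apply_mem h x
  have h2 := Submodule.projection_apply_mem h.symm x
  simp [transverseDilation, Submodule.projection_apply_of_mem_left _ h1,
    Submodule.projection_apply_of_mem_left _ h2, (Submodule.projection_apply_eq_zero_iff _).2 h1,
    (Submodule.projection_apply_eq_zero_iff _).2 h2, smul_smul]

theorem transverseDilation_one (h : IsCompl W W') (x : E) : transverseDilation h 1 x = x := by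
  simp [transverseDilation, Submodule.projection_add_projection_eq_self]

theorem map_transverseDilation (h : IsCompl W W') {f : E →ₗ[ℝ] ℝ} (hf : ∀ w ∈ W, f w = 0)
    (t : ℝ) (x : E) : f (transverseDilation h t x) = t * f x := by
  have hx : f x = f (W'.projection W h.symm x) := by
    conv_lhs => rw [← Submodule.projection_add_projection_eq_self h x]
    rw [map_add, hf _ (Submodule.projection_apply_mem h x), zero_add]
  rw [hx]
  simp [transverseDilation, hf _ (Submodule.projection_apply_mem h x)]

end Dilation

/-! ### Laplace's method on a polyhedron -/

section Laplace

variable {ι E : Type*} [NormedAddCommGroup E] [NormedSpace ℝ E]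

/-- By convexity, a bound on the distance to a maximum point `y₀` of `φ` on a superlevel set
propagates to a linear bound in terms of the defect of `φ`. -/
theorem Convex.exists_norm_sub_le {Q : Set E} (hQ : Convex ℝ Q) {φ : E →ₗ[ℝ] ℝ} {y₀ : E}
    (hy₀ : y₀ ∈ Q) (hmax : ∀ z ∈ Q, φ z ≤ φ y₀)
    (hbdd : Bornology.IsBounded (Q ∩ {y | φ y₀ - 1 ≤ φ y})) :
    ∃ R > 0, ∀ y ∈ Q, ‖y - y₀‖ ≤ R * (1 + (φ y₀ - φ y)) := by
  obtain ⟨R, hR, hsub⟩ := hbdd.subset_closedBall_lt 0 y₀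
  have hnear : ∀ y ∈ Q, φ y₀ - 1 ≤ φ y → ‖y - y₀‖ ≤ R := fun y hy h => by
    simpa [dist_eq_norm] using hsub ⟨hy, h⟩
  refine ⟨R, hR, fun y hy => ?_⟩
  have hle := hmax y hy
  rcases le_total (φ y₀ - 1) (φ y) with h | h
  · have := hnear y hy h
    nlinarith
  · set s := φ y₀ - φ y with hs
    have hs1 : 1 ≤ s := by linarith
    have hs0 : 0 < s := by linarith
    have hmem : y₀ + s⁻¹ • (y - y₀) ∈ Q := by
      have := hQ hy₀ hy (a := 1 - s⁻¹) (b := s⁻¹) (sub_nonneg.2 (inv_le_one_of_one_le₀ hs1))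
        (by positivity) (by ring)
      convert this using 1
      module
    have hval : φ (y₀ + s⁻¹ • (y - y₀)) = φ y₀ - 1 := by
      have : φ y - φ y₀ = - s := by rw [hs]; ring
      rw [map_add, map_smul, map_sub, this, smul_eq_mul, mul_neg, inv_mul_cancel₀ hs0.ne']
      ring
    have := hnear _ hmem hval.ge
    rw [add_sub_cancel_left, norm_smul, norm_inv, Real.norm_eq_abs, abs_of_pos hs0,
      inv_mul_le_iff₀ hs0] at this
    nlinarith

variable [FiniteDimensional ℝ E] [MeasurableSpace E] [BorelSpace E]
  (μ : Measure E) [μ.IsAddHaarMeasure]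

/-- The substitution `y = y₀ + w + w' / L`, with `w` along `W` and `w'` along `W'`, in the integral
of `exp (L φ)` over a set, where `φ` vanishes on `W`. -/
theorem setLIntegral_exp_eq_transverseDilation {Q : Set E} (hQ : IsClosed Q) {W W' : Submodule ℝ E}
    (h : IsCompl W W') {φ : E →ₗ[ℝ] ℝ} (hφ : ∀ w ∈ W, φ w = 0) (y₀ : E) {L : ℝ} (hL : 0 < L) :
    ∫⁻ y in Q, ENNReal.ofReal (Real.exp (L * φ y)) ∂μ =
      ENNReal.ofReal (Real.exp (L * φ y₀) * L⁻¹ ^ Module.finrank ℝ W') *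
        ∫⁻ z in (fun z => y₀ + transverseDilation h L⁻¹ z) ⁻¹' Q,
          ENNReal.ofReal (Real.exp (φ z)) ∂μ := by
  set A := transverseDilation h L⁻¹ with hA
  set f : E → E := fun z => y₀ + A z with hf
  have hAc : Continuous A := A.continuous_of_finiteDimensional
  have hfc : Continuous f := continuous_const.add hAc
  have hinv : ∀ x, transverseDilation h L (A x) = x := fun x => by
    rw [hA, transverseDilation_comp, mul_inv_cancel₀ hL.ne', transverseDilation_one]
  have hinj : Function.Injective f := fun x y hxy => by
    rw [← hinv x, ← hinv y, add_left_cancel hxy]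
  have hsurj : Function.Surjective f := fun y => ⟨transverseDilation h L (y - y₀), by
    simp only [hf, hA]
    rw [transverseDilation_comp, inv_mul_cancel₀ hL.ne', transverseDilation_one,
      add_sub_cancel]⟩
  have hderiv : ∀ x ∈ f ⁻¹' Q, HasFDerivWithinAt f (LinearMap.toContinuousLinearMap A)
      (f ⁻¹' Q) x := fun x _ =>
    ((LinearMap.toContinuousLinearMap A).hasFDerivAt.const_add y₀).hasFDerivWithinAt
  have key := lintegral_image_eq_lintegral_abs_det_fderiv_mul μ (hQ.preimage hfc).measurableSet
    hderiv hinj.injOn (fun y => ENNReal.ofReal (Real.exp (L * φ y)))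
  rw [image_preimage_eq _ hsurj] at key
  rw [key, ← lintegral_const_mul' _ _ ENNReal.ofReal_ne_top]
  congr 1
  ext z
  rw [← ENNReal.ofReal_mul (by positivity), ← ENNReal.ofReal_mul (by positivity)]
  congr 1
  have hdet : (LinearMap.toContinuousLinearMap A).det = L⁻¹ ^ Module.finrank ℝ W' := by
    rw [LinearMap.det_toContinuousLinearMap, hA, det_transverseDilation]
  rw [hdet, abs_of_pos (by positivity), map_add, hA, map_transverseDilation h hφ, mul_add,
    mul_inv_cancel_left₀ hL.ne', Real.exp_add]
  ring

variable {μ} [Finite ι] {ℓ : ι → E →ₗ[ℝ] ℝ} {c : ι → ℝ} {φ : E →ₗ[ℝ] ℝ} {m : ℝ}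

/-- Laplace's method on a polyhedron: the integral of `exp (L φ)` is of the order
`exp (L m) / L ^ k`, where `k` is the codimension of the face on which `φ` attains its maximum
`m`. Rescaling by `L` transversally to that face turns `exp (L (φ - m))` into `exp φ` and the
polyhedron into domains that contain a fixed set of positive measure and on which `φ` is at most
`1 - ‖z‖ / K`. -/
theorem exists_laplace_bounds (hne : (levelFace ℓ c φ m).Nonempty)
    (hmax : ∀ z ∈ polyhedron ℓ c, φ z ≤ m) (hμ : 0 < μ (polyhedron ℓ c))
    (hfin : ∫⁻ y in polyhedron ℓ c, ENNReal.ofReal (Real.exp (φ y)) ∂μ < ⊤) :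
    ∃ κ : ℝ, 0 < κ ∧ ∀ L : ℝ, 1 ≤ L →
      ENNReal.ofReal (κ⁻¹ *
        (Real.exp (L * m) * L ^ Module.finrank ℝ (vectorSpan ℝ (levelFace ℓ c φ m)))) ≤
        ENNReal.ofReal (L ^ Module.finrank ℝ E) *
          ∫⁻ y in polyhedron ℓ c, ENNReal.ofReal (Real.exp (L * φ y)) ∂μ ∧
      ENNReal.ofReal (L ^ Module.finrank ℝ E) *
          ∫⁻ y in polyhedron ℓ c, ENNReal.ofReal (Real.exp (L * φ y)) ∂μ ≤
        ENNReal.ofReal (κ *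
          (Real.exp (L * m) * L ^ Module.finrank ℝ (vectorSpan ℝ (levelFace ℓ c φ m)))) := by
  obtain ⟨y₀, hy₀, hstrict⟩ := exists_strict_mem_levelFace hne
  have hQ : Convex ℝ (polyhedron ℓ c) := convex_polyhedron
  have hφc : Continuous φ := φ.continuous_of_finiteDimensional
  have hint := hQ.interior_nonempty_of_measure_pos hμ
  set F := levelFace ℓ c φ m with hF
  obtain ⟨W', hW⟩ := (vectorSpan ℝ F).exists_isCompl
  have hφW : ∀ w ∈ vectorSpan ℝ F, φ w = 0 := fun w hw =>
    map_eq_zero_of_mem_vectorSpan (fun y hy => hy.2) hw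
  obtain ⟨δ, hδ, hsharp⟩ := exists_mul_norm_projection_le hy₀ hstrict hmax hW
  obtain ⟨R, hR, hRb⟩ := hQ.exists_norm_sub_le hy₀.1 (fun z hz => (hmax z hz).trans hy₀.2.ge)
    (hQ.isBounded_superlevel hint φ hfin _)
  obtain ⟨ρ, hρ, hnear⟩ := exists_add_mem_polyhedron_iff hy₀ hstrict
  set T := tangentConeAlong ℓ c F with hT
  let D : ℝ → Set E := fun L => (fun z => y₀ + transverseDilation hW L⁻¹ z) ⁻¹' polyhedron ℓ c
  let p : E →ₗ[ℝ] E := (vectorSpan ℝ F).projection W' hW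
  let p' : E →ₗ[ℝ] E := W'.projection _ hW.symm
  have hpp : ∀ z, p z + p' z = z := fun z => Submodule.projection_add_projection_eq_self hW z
  have hpc : Continuous p := p.continuous_of_finiteDimensional
  have hpc' : Continuous p' := p'.continuous_of_finiteDimensional
  have hdil : ∀ t z, transverseDilation hW t z = p z + t • p' z := fun t z => rfl
  have hpW : ∀ z, p z ∈ vectorSpan ℝ F := fun z => Submodule.projection_apply_mem hW z
  have hTiff : ∀ z, p' z ∈ T ↔ z ∈ T := fun z => by
    conv_rhs => rw [← hpp z]
    exact (add_mem_tangentConeAlong_iff (hpW z)).symm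
  -- A fixed set of positive measure contained in all the rescaled domains.
  set U : Set E := T ∩ {z | ‖p z‖ + ‖p' z‖ < ρ} with hU
  have hopen : IsOpen {z | ‖p z‖ + ‖p' z‖ < ρ} :=
    isOpen_lt (hpc.norm.add hpc'.norm) continuous_const
  have hUmeas : MeasurableSet U :=
    isClosed_tangentConeAlong.measurableSet.inter hopen.measurableSet
  have hUpos : 0 < μ U := by
    obtain ⟨y₁, hy₁⟩ := hint
    set a := ‖p (y₁ - y₀)‖ + ‖p' (y₁ - y₀)‖ with ha
    have ha0 : 0 ≤ a := by positivity
    obtain ⟨s, hs, hsa⟩ : ∃ s : ℝ, 0 < s ∧ s * a < ρ := by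
      refine ⟨ρ / (a + 1), by positivity, ?_⟩
      rw [div_mul_eq_mul_div, div_lt_iff₀ (by positivity)]
      nlinarith
    have hcont : Continuous fun z : E => y₀ + s⁻¹ • z := by fun_prop
    have hO : IsOpen ((fun z : E => y₀ + s⁻¹ • z) ⁻¹' interior (polyhedron ℓ c) ∩
        {z | ‖p z‖ + ‖p' z‖ < ρ}) := (isOpen_interior.preimage hcont).inter hopen
    refine (hO.measure_pos μ ⟨s • (y₁ - y₀), ?_, ?_⟩).trans_le (measure_mono ?_)
    · simpa [smul_smul, inv_mul_cancel₀ hs.ne'] using hy₁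
    · simp only [mem_ofPred_eq, map_smul, norm_smul, Real.norm_eq_abs, abs_of_pos hs]
      rwa [← mul_add]
    · rintro z ⟨hz, hzρ⟩
      refine ⟨?_, hzρ⟩
      have h1 : s⁻¹ • z ∈ T := by
        have := sub_mem_tangentConeAlong hy₀ (interior_subset hz)
        rwa [add_sub_cancel_left] at this
      have := smul_mem_tangentConeAlong h1 hs.le
      rwa [smul_smul, mul_inv_cancel₀ hs.ne', one_smul] at this
  have hUD : ∀ L, 1 ≤ L → U ⊆ D L := by
    rintro L hL z ⟨hzT, hz⟩
    have hL' : L⁻¹ ≤ 1 := inv_le_one_of_one_le₀ hL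
    have hL0 : 0 ≤ L⁻¹ := inv_nonneg.2 (by linarith)
    refine hnear _ ?_ ?_
    · rw [hdil]
      refine lt_of_le_of_lt ((norm_add_le _ _).trans ?_) hz
      rw [norm_smul, Real.norm_eq_abs, abs_of_nonneg hL0]
      gcongr
      exact mul_le_of_le_one_left (norm_nonneg _) hL'
    · rw [hdil]
      exact (add_mem_tangentConeAlong_iff (hpW z)).2
        (smul_mem_tangentConeAlong ((hTiff z).2 hzT) hL0)
  -- The exponential decay on all the rescaled domains.
  set K : ℝ := R + 2 / δ with hK
  have hK0 : 0 < K := by positivity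
  have hDK : ∀ L, 1 ≤ L → ∀ z ∈ D L, φ z ≤ 1 - K⁻¹ * ‖z‖ := by
    intro L hL z hz
    have hL0 : 0 < L := by linarith
    set v := transverseDilation hW L⁻¹ z with hv
    have hvQ : y₀ + v ∈ polyhedron ℓ c := hz
    have hvT : v ∈ T := by simpa using sub_mem_tangentConeAlong hy₀ hvQ
    have hφv : φ v = L⁻¹ * φ z := map_transverseDilation hW hφW _ _
    have hp'v : p' v = L⁻¹ • p' z := by
      have h1 : p' (p z) = 0 := (Submodule.projection_apply_eq_zero_iff _).2 (hpW z)
      have h2 : p' (p' z) = p' z := Submodule.projection_apply_of_mem_left _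
        (Submodule.projection_apply_mem hW.symm z)
      rw [hv, hdil, map_add, map_smul, h1, h2, zero_add]
    have h1 : δ * ‖p' z‖ ≤ - φ z := by
      have : δ * ‖p' v‖ ≤ - φ v := hsharp v hvT
      rw [hp'v, norm_smul, norm_inv, Real.norm_eq_abs, abs_of_pos hL0, hφv, ← mul_neg,
        mul_left_comm] at this
      exact le_of_mul_le_mul_left this (by positivity)
    have hφz : φ z ≤ 0 := by
      have : 0 ≤ δ * ‖p' z‖ := by positivity
      linarith
    have hLinv : L⁻¹ ≤ 1 := inv_le_one_of_one_le₀ hL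
    have hLinv0 : 0 < L⁻¹ := by positivity
    have h2 : ‖v‖ ≤ R * (1 - φ z) := by
      have := hRb _ hvQ
      rw [add_sub_cancel_left, map_add, hφv] at this
      refine this.trans ?_
      gcongr
      nlinarith
    have h3 : ‖p z‖ ≤ ‖v‖ + ‖p' z‖ := by
      have : p z = v - L⁻¹ • p' z := by rw [hv, hdil]; abel
      rw [this]
      refine (norm_sub_le _ _).trans ?_
      rw [norm_smul, Real.norm_eq_abs, abs_of_pos hLinv0]
      gcongr
      exact mul_le_of_le_one_left (norm_nonneg _) hLinv
    have h4 : ‖z‖ ≤ ‖p z‖ + ‖p' z‖ := by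
      conv_lhs => rw [← hpp z]
      exact norm_add_le _ _
    have h5 : ‖p' z‖ ≤ 1 / δ * (1 - φ z) := by
      rw [div_mul_eq_mul_div, le_div_iff₀ hδ]
      linarith
    have h6 : ‖z‖ ≤ K * (1 - φ z) := by
      have : K * (1 - φ z) = R * (1 - φ z) + (1 / δ * (1 - φ z) + 1 / δ * (1 - φ z)) := by
        rw [hK]; ring
      linarith
    rw [← inv_mul_le_iff₀ hK0] at h6
    linarith
  set k₁ := ∫⁻ z in U, ENNReal.ofReal (Real.exp (φ z)) ∂μ with hk₁
  set k₂ := ∫⁻ z : E, ENNReal.ofReal (Real.exp (1 - K⁻¹ * ‖z‖)) ∂μ with hk₂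
  have hk₂fin : k₂ < ⊤ := by
    have : k₂ = ENNReal.ofReal (Real.exp 1) *
        ∫⁻ z : E, ENNReal.ofReal (Real.exp (-(K⁻¹ * ‖z‖))) ∂μ := by
      rw [hk₂, ← lintegral_const_mul' _ _ ENNReal.ofReal_ne_top]
      congr 1
      ext z
      rw [← ENNReal.ofReal_mul (Real.exp_pos _).le, ← Real.exp_add, sub_eq_add_neg]
    rw [this]
    exact ENNReal.mul_lt_top ENNReal.ofReal_lt_top
      (lintegral_exp_neg_mul_norm_lt_top (inv_pos.2 hK0))
  have hlow : ∀ L, 1 ≤ L → k₁ ≤ ∫⁻ z in D L, ENNReal.ofReal (Real.exp (φ z)) ∂μ :=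
    fun L hL => lintegral_mono_set (hUD L hL)
  have hDmeas : ∀ L, MeasurableSet (D L) := fun L =>
    (isClosed_polyhedron.preimage (continuous_const.add
      (transverseDilation hW L⁻¹).continuous_of_finiteDimensional)).measurableSet
  have hup : ∀ L, 1 ≤ L → ∫⁻ z in D L, ENNReal.ofReal (Real.exp (φ z)) ∂μ ≤ k₂ :=
    fun L hL => (setLIntegral_mono' (hDmeas L) fun z hz => ENNReal.ofReal_le_ofReal
      (Real.exp_le_exp.2 (hDK L hL z hz))).trans (setLIntegral_le_lintegral _ _)
  have hk₁pos : k₁ ≠ 0 := by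
    rw [hk₁, Ne, lintegral_eq_zero_iff (by fun_prop)]
    intro h0
    rw [Filter.EventuallyEq, ae_restrict_iff' hUmeas] at h0
    refine hUpos.ne' (measure_mono_null (fun z hz => ?_) h0)
    simp only [mem_compl_iff, mem_ofPred_eq]
    intro h
    have := h hz
    simp only [Pi.zero_apply, ENNReal.ofReal_eq_zero] at this
    exact (Real.exp_pos _).not_ge this
  have hk₁fin : k₁ < ⊤ := ((hlow 1 le_rfl).trans (hup 1 le_rfl)).trans_lt hk₂fin
  have ha : 0 < k₁.toReal := ENNReal.toReal_pos hk₁pos hk₁fin.ne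
  refine ⟨k₁.toReal⁻¹ + k₂.toReal, add_pos_of_pos_of_nonneg (inv_pos.2 ha) ENNReal.toReal_nonneg, fun L hL => ?_⟩
  have hL0 : 0 < L := by linarith
  have hdim : Module.finrank ℝ (vectorSpan ℝ F) + Module.finrank ℝ W' = Module.finrank ℝ E :=
    Submodule.finrank_add_eq_of_isCompl hW
  set d := Module.finrank ℝ (vectorSpan ℝ F)
  have hmain : ENNReal.ofReal (L ^ Module.finrank ℝ E) *
      ∫⁻ y in polyhedron ℓ c, ENNReal.ofReal (Real.exp (L * φ y)) ∂μ =
      ENNReal.ofReal (Real.exp (L * m) * L ^ d) *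
        ∫⁻ z in D L, ENNReal.ofReal (Real.exp (φ z)) ∂μ := by
    rw [setLIntegral_exp_eq_transverseDilation μ isClosed_polyhedron hW hφW y₀ hL0, ← mul_assoc,
      ← ENNReal.ofReal_mul (by positivity), hy₀.2, ← hdim, pow_add]
    congr 2
    have : L ^ Module.finrank ℝ W' * L⁻¹ ^ Module.finrank ℝ W' = 1 := by
      rw [← mul_pow, mul_inv_cancel₀ hL0.ne', one_pow]
    linear_combination (L ^ d * Real.exp (L * m)) * this
  have hpos : 0 < Real.exp (L * m) * L ^ d := by positivity
  rw [hmain]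
  constructor
  · rw [mul_comm, ENNReal.ofReal_mul hpos.le]
    gcongr
    refine le_trans ?_ (hlow L hL)
    refine ENNReal.ofReal_le_of_le_toReal ?_
    rw [inv_le_comm₀ (add_pos_of_pos_of_nonneg (inv_pos.2 ha) ENNReal.toReal_nonneg) ha]
    have : 0 ≤ k₂.toReal := ENNReal.toReal_nonneg
    linarith
  · rw [mul_comm (_ + _), ENNReal.ofReal_mul hpos.le]
    gcongr
    refine (hup L hL).trans ?_
    rw [ENNReal.le_ofReal_iff_toReal_le hk₂fin.ne (by positivity)]
    have := inv_pos.2 ha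
    linarith

end Laplace

/-! ### Rational linear programs -/

section Rationality

variable {ι κ : Type*} [Fintype κ]

/-- The linear form `y ↦ ∑ i, a i * y i`. -/
def linearForm (a : κ → ℝ) : (κ → ℝ) →ₗ[ℝ] ℝ :=
  ∑ i, a i • LinearMap.proj i

theorem linearForm_apply (a y : κ → ℝ) : linearForm a y = ∑ i, a i * y i := by
  simp [linearForm]

/-- The maximum of a linear program with rational data is rational. A `ℚ`-linear retraction of `ℝ`
onto `ℚ`, applied to the coordinates of a relative interior point of the maximal face, yields a
rational point of the affine hull of that face, on which the objective function is constant. -/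
theorem exists_rat_eq_of_isMax [Finite ι] {A : ι → κ → ℝ} {c : ι → ℝ} {g : κ → ℝ} {m : ℝ}
    (hA : ∀ j i, ∃ q : ℚ, A j i = q) (hc : ∀ j, ∃ q : ℚ, c j = q) (hg : ∀ i, ∃ q : ℚ, g i = q)
    (hne : (levelFace (fun j => linearForm (A j)) c (linearForm g) m).Nonempty)
    (hmax : ∀ z ∈ polyhedron (fun j => linearForm (A j)) c, linearForm g z ≤ m) :
    ∃ q : ℚ, m = q := by
  obtain ⟨y₀, hy₀, hstrict⟩ := exists_strict_mem_levelFace hne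
  obtain ⟨π, hπ⟩ := (Algebra.linearMap ℚ ℝ).exists_leftInverse_of_injective
    (LinearMap.ker_eq_bot.2 (algebraMap ℚ ℝ).injective)
  have hπq : ∀ q : ℚ, π (q : ℝ) = q := fun q => by
    simpa using LinearMap.congr_fun hπ q
  have hπmul : ∀ (q : ℚ) (x : ℝ), π (q * x) = q * π x := fun q x => by
    rw [← Rat.smul_def, map_smul, smul_eq_mul]
  set y : κ → ℝ := fun i => (π (y₀ i) : ℝ)
  have hform : ∀ a : κ → ℝ, (∀ i, ∃ q : ℚ, a i = q) →
      linearForm a y = (π (linearForm a y₀) : ℝ) := by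
    intro a ha
    choose q hq using ha
    rw [linearForm_apply, linearForm_apply, map_sum, Rat.cast_sum]
    refine Finset.sum_congr rfl fun i _ => ?_
    rw [hq, hπmul, Rat.cast_mul]
  have htight : ∀ j, (∀ z ∈ levelFace (fun j => linearForm (A j)) c (linearForm g) m,
      linearForm (A j) z = c j) → linearForm (A j) (y - y₀) = 0 := by
    intro j hj
    obtain ⟨q, hq⟩ := hc j
    rw [map_sub, hform _ (hA j), hj y₀ hy₀, hq, hπq, sub_self]
  have h1 := map_nonpos_of_mem_tangentConeAlong hy₀ hstrict hmax (v := y - y₀)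
    fun j hj => (htight j hj).le
  have h2 := map_nonpos_of_mem_tangentConeAlong hy₀ hstrict hmax (v := -(y - y₀))
    fun j hj => by rw [map_neg, htight j hj, neg_zero]
  refine ⟨π m, ?_⟩
  rw [map_neg] at h2
  rw [map_sub, hform g hg, hy₀.2] at h1 h2
  linarith

end Rationality

namespace MonomialIntegral

variable {N : ℕ} {G : Finset ((Fin N → ℕ) × ℝ)} {b : Fin N → ℕ}

/-! ### The polyhedra of the statement -/

/-- The coefficients of the linear constraints that define `P G p`. -/
def constraintCoeff (G : Finset ((Fin N → ℕ) × ℝ)) (p : (Fin N → ℕ) × ℝ) :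
    Fin N ⊕ G → Fin N → ℝ :=
  Sum.elim (fun i => -Pi.single i 1) fun p' i => (p.1 i : ℝ) - (p'.1.1 i : ℝ)

/-- The right-hand sides of the linear constraints that define `P G p`. -/
def constraintBound (G : Finset ((Fin N → ℕ) × ℝ)) (p : (Fin N → ℕ) × ℝ) : Fin N ⊕ G → ℝ :=
  Sum.elim (fun _ => 0) fun p' => p'.1.2 - p.2

theorem P_eq_polyhedron (p : (Fin N → ℕ) × ℝ) :
    P G p = polyhedron (fun j => linearForm (constraintCoeff G p j)) (constraintBound G p) := by
  ext y
  simp [P, polyhedron, linearForm_apply, constraintCoeff, constraintBound, Pi.single_apply]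

theorem phi_eq_linearForm (a : Fin N → ℕ) :
    phi b a = linearForm fun i => (a i : ℝ) - (b i : ℝ) - 1 := by
  ext y
  rw [linearForm_apply, phi]

theorem isClosed_P (p : (Fin N → ℕ) × ℝ) : IsClosed (P G p) := by
  rw [P_eq_polyhedron]
  exact isClosed_polyhedron

/-- On `P G p`, the exponent of the term `p` is minimal among those of all terms of the
denominator. -/
theorem phi_add_le_of_mem_P {p p' : (Fin N → ℕ) × ℝ} (hp' : p' ∈ G) {y : Fin N → ℝ}
    (hy : y ∈ P G p) : phi b p.1 y + p.2 ≤ phi b p'.1 y + p'.2 := by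
  have h := hy.2 p' hp'
  have : phi b p.1 y - phi b p'.1 y = ∑ i, ((p.1 i : ℝ) - (p'.1 i : ℝ)) * y i := by
    rw [phi, phi, ← Finset.sum_sub_distrib]
    exact Finset.sum_congr rfl fun i _ => by ring
  linarith

/-- The polyhedra `P G p` cover the orthant: a term with minimal exponent at `y` has `y` in its
polyhedron. -/
theorem exists_mem_P (hG : G.Nonempty) {y : Fin N → ℝ} (hy : ∀ i, 0 ≤ y i) :
    ∃ p ∈ G, y ∈ P G p := by
  obtain ⟨p, hp, hmin⟩ := G.exists_min_image (fun p => ∑ i, (p.1 i : ℝ) * y i + p.2) hG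
  refine ⟨p, hp, hy, fun p' hp' => ?_⟩
  have h := hmin p' hp'
  have : ∑ i, ((p.1 i : ℝ) - (p'.1 i : ℝ)) * y i =
      ∑ i, (p.1 i : ℝ) * y i - ∑ i, (p'.1 i : ℝ) * y i := by
    rw [← Finset.sum_sub_distrib]
    exact Finset.sum_congr rfl fun i _ => by ring
  linarith

/-! ### The substitution `x = exp (-L y)` -/

theorem monomial_exp (a : Fin N → ℕ) (L : ℝ) (y : Fin N → ℝ) :
    monomial a (fun i => Real.exp (-L * y i)) = Real.exp (-L * ∑ i, (a i : ℝ) * y i) := by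
  rw [monomial, Finset.mul_sum, Real.exp_sum]
  refine Finset.prod_congr rfl fun i _ => ?_
  rw [← Real.exp_nat_mul]
  ring_nf

theorem image_exp_orthant {L : ℝ} (hL : 0 < L) :
    (fun (y : Fin N → ℝ) i => Real.exp (-L * y i)) '' {y | ∀ i, 0 ≤ y i} = cube N := by
  ext x
  constructor
  · rintro ⟨y, hy, rfl⟩ i
    refine ⟨Real.exp_pos _, Real.exp_le_one_iff.2 ?_⟩
    have := mul_nonneg hL.le (hy i)
    linarith
  · intro hx
    refine ⟨fun i => -Real.log (x i) / L, fun i => ?_, ?_⟩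
    · have := Real.log_nonpos (hx i).1.le (hx i).2
      exact div_nonneg (by linarith) hL.le
    · ext i
      have : -L * (-Real.log (x i) / L) = Real.log (x i) := by field_simp
      simp only [this, Real.exp_log (hx i).1]

theorem hasFDerivAt_exp_neg_mul (L : ℝ) (y : Fin N → ℝ) :
    HasFDerivAt (fun (y : Fin N → ℝ) i => Real.exp (-L * y i))
      (LinearMap.toContinuousLinearMap
        (Matrix.toLin' (Matrix.diagonal fun i => -L * Real.exp (-L * y i)))) y := by
  rw [hasFDerivAt_pi']
  intro i
  have h1 : HasDerivAt (fun t : ℝ => Real.exp (-L * t)) (-L * Real.exp (-L * y i)) (y i) := by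
    have := ((hasDerivAt_id (y i)).const_mul (-L)).exp
    simpa [mul_comm] using this
  have h2 := h1.comp_hasFDerivAt y
    (ContinuousLinearMap.proj (R := ℝ) (φ := fun _ : Fin N => ℝ) i).hasFDerivAt
  refine h2.congr_fderiv ?_
  ext v
  simp [Matrix.mulVec_diagonal]

/-- The integral in logarithmic coordinates. The Jacobian `L ^ N exp (-L ∑ y i)` and the numerator
combine with the terms of the denominator to the exponents `phi b a y + s`. -/
theorem I_exp_neg (hG : G.Nonempty) {L : ℝ} (hL : 0 < L) :
    I G b (Real.exp (-L)) = ENNReal.ofReal (L ^ N) * ∫⁻ y in {y : Fin N → ℝ | ∀ i, 0 ≤ y i},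
      ENNReal.ofReal (∑ p ∈ G, Real.exp (-L * (phi b p.1 y + p.2)))⁻¹ := by
  have hmeas : MeasurableSet {y : Fin N → ℝ | ∀ i, 0 ≤ y i} := by
    rw [ofPred_forall]
    exact MeasurableSet.iInter fun i => measurableSet_le measurable_const (measurable_pi_apply i)
  have hinj : Function.Injective fun (y : Fin N → ℝ) i => Real.exp (-L * y i) := by
    intro y z h
    ext i
    have := Real.exp_injective (congr_fun h i)
    exact mul_left_cancel₀ (neg_ne_zero.2 hL.ne') this
  rw [I, ← image_exp_orthant hL, lintegral_image_eq_lintegral_abs_det_fderiv_mul volume hmeas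
    (fun y _ => (hasFDerivAt_exp_neg_mul L y).hasFDerivWithinAt) hinj.injOn,
    ← lintegral_const_mul' _ _ ENNReal.ofReal_ne_top]
  congr 1
  ext y
  have hdet : |(LinearMap.toContinuousLinearMap (Matrix.toLin' (Matrix.diagonal fun i =>
      -L * Real.exp (-L * y i)))).det| = L ^ N * Real.exp (-L * ∑ i, y i) := by
    rw [LinearMap.det_toContinuousLinearMap, LinearMap.det_toLin', Matrix.det_diagonal,
      Finset.abs_prod, Finset.mul_sum, Real.exp_sum]
    simp [abs_mul, abs_of_pos hL, Finset.prod_mul_distrib]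
  have hden : ∑ p ∈ G, monomial p.1 (fun i => Real.exp (-L * y i)) * Real.exp (-L) ^ p.2 =
      Real.exp (-L * ∑ i, ((b i : ℝ) + 1) * y i) *
        ∑ p ∈ G, Real.exp (-L * (phi b p.1 y + p.2)) := by
    rw [Finset.mul_sum]
    refine Finset.sum_congr rfl fun p _ => ?_
    rw [monomial_exp, ← Real.exp_mul, ← Real.exp_add, ← Real.exp_add, ← mul_add, ← mul_add]
    congr 2
    rw [phi, ← add_assoc, ← Finset.sum_add_distrib]
    congr 1
    exact Finset.sum_congr rfl fun i _ => by ring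
  have hpos : 0 < ∑ p ∈ G, Real.exp (-L * (phi b p.1 y + p.2)) :=
    Finset.sum_pos (fun _ _ => Real.exp_pos _) hG
  rw [hdet, hden, monomial_exp, ← ENNReal.ofReal_div_of_pos (by positivity),
    ← ENNReal.ofReal_mul (by positivity), ← ENNReal.ofReal_mul (by positivity)]
  congr 1
  have hsplit : Real.exp (-L * ∑ i, ((b i : ℝ) + 1) * y i) =
      Real.exp (-L * ∑ i, y i) * Real.exp (-L * ∑ i, (b i : ℝ) * y i) := by
    rw [← Real.exp_add, ← mul_add, ← Finset.sum_add_distrib]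
    congr 2
    exact Finset.sum_congr rfl fun i _ => by ring
  rw [hsplit]
  field_simp

/-! ### Splitting the integral over the regions `P G p` -/

/-- The contribution of the region `P G p` to the integral `I G b (exp (-L))`. -/
noncomputable def contribution (G : Finset ((Fin N → ℕ) × ℝ)) (b : Fin N → ℕ)
    (p : (Fin N → ℕ) × ℝ) (L : ℝ) : ENNReal :=
  ENNReal.ofReal (Real.exp (L * p.2)) * (ENNReal.ofReal (L ^ N) *
    ∫⁻ y in P G p, ENNReal.ofReal (Real.exp (L * phi b p.1 y)))

theorem contribution_eq (p : (Fin N → ℕ) × ℝ) {L : ℝ} :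
    contribution G b p L = ENNReal.ofReal (L ^ N) *
      ∫⁻ y in P G p, ENNReal.ofReal (Real.exp (L * (phi b p.1 y + p.2))) := by
  rw [contribution, mul_left_comm, ← lintegral_const_mul' _ _ ENNReal.ofReal_ne_top]
  congr 2
  ext y
  rw [← ENNReal.ofReal_mul (Real.exp_pos _).le, ← Real.exp_add]
  ring_nf

theorem _root_.MeasureTheory.setLIntegral_biUnion_finset_le {α κ : Type*} [MeasurableSpace α]
    {μ : Measure α} (s : Finset κ) (t : κ → Set α) (f : α → ENNReal) :
    ∫⁻ x in ⋃ i ∈ s, t i, f x ∂μ ≤ ∑ i ∈ s, ∫⁻ x in t i, f x ∂μ := by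
  classical
  induction s using Finset.induction_on with
  | empty => simp
  | insert i s hi ih =>
    rw [Finset.set_biUnion_insert, Finset.sum_insert hi]
    exact (lintegral_union_le _ _ _).trans (by gcongr)

/-- The denominator is at least the term `p`, and the regions `P G p` of positive volume cover the
orthant up to a null set. -/
theorem I_le_sum_contribution (hG : G.Nonempty) {L : ℝ} (hL : 0 < L) :
    I G b (Real.exp (-L)) ≤ ∑ p ∈ Gcirc G, contribution G b p L := by
  have hnull : ∀ p ∈ G, p ∉ Gcirc G → contribution G b p L = 0 := by
    intro p hp hp'
    have h0 : volume (P G p) = 0 := by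
      simpa [Gcirc, hp] using hp'
    rw [contribution, Measure.restrict_eq_zero.2 h0]
    simp
  have hsub : Gcirc G ⊆ G := Finset.filter_subset _ _
  rw [Finset.sum_subset hsub hnull, I_exp_neg hG hL,
    Finset.sum_congr rfl fun p _ => contribution_eq (G := G) (b := b) p, ← Finset.mul_sum]
  set w : (Fin N → ℝ) → ENNReal := fun y =>
    ENNReal.ofReal (∑ p ∈ G, Real.exp (-L * (phi b p.1 y + p.2)))⁻¹ with hw
  refine mul_le_mul_right ?_ _
  have hcover : {y : Fin N → ℝ | ∀ i, 0 ≤ y i} ⊆ ⋃ p ∈ G, P G p := fun y hy => by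
    obtain ⟨p, hp, h⟩ := exists_mem_P hG hy
    exact mem_iUnion₂.2 ⟨p, hp, h⟩
  refine ((lintegral_mono_set hcover).trans (setLIntegral_biUnion_finset_le G _ w)).trans ?_
  refine Finset.sum_le_sum fun p hp => ?_
  refine setLIntegral_mono' (isClosed_P p).measurableSet fun y hy => ?_
  refine ENNReal.ofReal_le_ofReal ?_
  have hterm : Real.exp (-L * (phi b p.1 y + p.2)) ≤
      ∑ p ∈ G, Real.exp (-L * (phi b p.1 y + p.2)) :=
    Finset.single_le_sum (f := fun p : (Fin N → ℕ) × ℝ => Real.exp (-L * (phi b p.1 y + p.2)))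
      (fun _ _ => (Real.exp_pos _).le) hp
  refine (inv_anti₀ (Real.exp_pos _) hterm).trans_eq ?_
  rw [← Real.exp_neg, neg_mul, neg_neg]

/-- On `P G p` the term `p` is the largest of the denominator, which is thus at most `G.card` times
that term. -/
theorem contribution_le (hG : G.Nonempty) (p : (Fin N → ℕ) × ℝ) {L : ℝ} (hL : 0 < L) :
    contribution G b p L ≤ G.card * I G b (Real.exp (-L)) := by
  have hcard : (0 : ℝ) < G.card := by exact_mod_cast hG.card_pos
  rw [I_exp_neg hG hL, contribution_eq, mul_left_comm]
  gcongr
  rw [← lintegral_const_mul' _ _ (ENNReal.natCast_ne_top _)]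
  refine (setLIntegral_mono' (isClosed_P p).measurableSet fun y hy => ?_).trans
    (lintegral_mono_set fun y hy => hy.1)
  rw [← ENNReal.ofReal_natCast, ← ENNReal.ofReal_mul hcard.le]
  apply ENNReal.ofReal_le_ofReal
  rw [← div_eq_mul_inv, le_div_iff₀ (Finset.sum_pos (fun _ _ => Real.exp_pos _) hG),
    Finset.mul_sum, ← nsmul_one, ← Finset.sum_const]
  refine Finset.sum_le_sum fun p' hp' => ?_
  rw [← Real.exp_add, Real.exp_le_one_iff]
  have := phi_add_le_of_mem_P (b := b) hp' hy
  nlinarith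

/-! ### Maxima and growth of the contributions -/

theorem mem_Gcirc {p : (Fin N → ℕ) × ℝ} : p ∈ Gcirc G ↔ p ∈ G ∧ 0 < volume (P G p) := by
  simp [Gcirc]

/-- For empty `G` the integrand is a positive number divided by `0`, which is `⊤` in `ℝ≥0∞`. -/
theorem nonempty_of_I_lt_top {r : ℝ} (h : I G b r < ⊤) : G.Nonempty := by
  by_contra hG
  rw [Finset.not_nonempty_iff_eq_empty] at hG
  subst hG
  have hcube : cube N = Set.pi univ fun _ => Ioc (0 : ℝ) 1 := by
    ext x
    simp [cube]
  have hmeas : MeasurableSet (cube N) := by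
    rw [hcube]
    exact MeasurableSet.univ_pi fun _ => measurableSet_Ioc
  refine h.ne ?_
  rw [I, setLIntegral_congr_fun (g := fun _ => ⊤) hmeas fun x hx => ?_, lintegral_const,
    Measure.restrict_apply_univ, hcube, Real.volume_pi_Ioc]
  · simp
  · have : 0 < monomial b x := Finset.prod_pos fun i _ => pow_pos (hx i).1 _
    simp [ENNReal.div_zero, this]

theorem Gcirc_nonempty (hG : G.Nonempty) : (Gcirc G).Nonempty := by
  by_contra h
  rw [Finset.not_nonempty_iff_eq_empty] at h
  have hzero : ∀ p ∈ G, volume (P G p) = 0 := fun p hp => by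
    by_contra h0
    have : p ∈ Gcirc G := mem_Gcirc.2 ⟨hp, pos_iff_ne_zero.2 h0⟩
    simp [h] at this
  have hopen : IsOpen (Set.pi univ fun _ : Fin N => Ioi (0 : ℝ)) :=
    isOpen_set_pi finite_univ fun _ _ => isOpen_Ioi
  refine (hopen.measure_pos volume ⟨fun _ => 1, fun _ _ => mem_Ioi.2 one_pos⟩).ne'
    (measure_mono_null (t := ⋃ p ∈ G, P G p) (fun y hy => ?_)
      ((measure_biUnion_null_iff G.countable_toSet).2 hzero))
  obtain ⟨p, hp, hyp⟩ := exists_mem_P hG fun i => le_of_lt (hy i (mem_univ i))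
  exact mem_iUnion₂.2 ⟨p, hp, hyp⟩

/-- Finiteness of the integral at `r = exp (-1)` makes `exp ∘ phi b a` integrable on `P G p`. -/
theorem setLIntegral_exp_phi_lt_top (hG : G.Nonempty) (h : I G b (Real.exp (-1)) < ⊤)
    (p : (Fin N → ℕ) × ℝ) :
    ∫⁻ y in P G p, ENNReal.ofReal (Real.exp (phi b p.1 y)) < ⊤ := by
  have h1 := (contribution_le (b := b) hG p one_pos).trans_lt
    (ENNReal.mul_lt_top (ENNReal.natCast_lt_top _) h)
  simp only [contribution, one_mul, one_pow, ENNReal.ofReal_one] at h1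
  rcases ENNReal.mul_lt_top_iff.1 h1 with h | h | h
  · exact h.2
  · exact absurd h (by simp [Real.exp_pos])
  · simp [h]

theorem isGreatest_m (hG : G.Nonempty) (h : I G b (Real.exp (-1)) < ⊤)
    {p : (Fin N → ℕ) × ℝ} (hp : p ∈ Gcirc G) : IsGreatest (phi b p.1 '' P G p) (m G b p) := by
  have hfin := setLIntegral_exp_phi_lt_top hG h p
  have hvol := (mem_Gcirc.1 hp).2
  obtain ⟨y, hy, hmax⟩ : ∃ y ∈ P G p, ∀ z ∈ P G p, phi b p.1 z ≤ phi b p.1 y := by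
    rw [phi_eq_linearForm] at hfin ⊢
    rw [P_eq_polyhedron] at hfin hvol ⊢
    exact convex_polyhedron.exists_isMaxOn_of_lintegral_exp isClosed_polyhedron
      (convex_polyhedron.interior_nonempty_of_measure_pos hvol) _ hfin
  have hgr : IsGreatest (phi b p.1 '' P G p) (phi b p.1 y) :=
    ⟨mem_image_of_mem _ hy, by rintro _ ⟨z, hz, rfl⟩; exact hmax z hz⟩
  rwa [m, hgr.csSup_eq]

theorem M_eq_levelFace (p : (Fin N → ℕ) × ℝ) :
    M G b p = levelFace (fun j => linearForm (constraintCoeff G p j)) (constraintBound G p)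
      (linearForm fun i => (p.1 i : ℝ) - (b i : ℝ) - 1) (m G b p) := by
  rw [M, levelFace, phi_eq_linearForm, P_eq_polyhedron]

/-- The order of growth of the contribution of `P G p`, in terms of `L = |log r|`. -/
noncomputable def growth (G : Finset ((Fin N → ℕ) × ℝ)) (b : Fin N → ℕ) (p : (Fin N → ℕ) × ℝ)
    (L : ℝ) : ℝ :=
  Real.exp (L * (p.2 + m G b p)) * L ^ d G b p

theorem levelFace_nonempty_and_le_m (hG : G.Nonempty) (h : I G b (Real.exp (-1)) < ⊤)
    {p : (Fin N → ℕ) × ℝ} (hp : p ∈ Gcirc G) :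
    (levelFace (fun j => linearForm (constraintCoeff G p j)) (constraintBound G p)
      (linearForm fun i => (p.1 i : ℝ) - (b i : ℝ) - 1) (m G b p)).Nonempty ∧
    ∀ z ∈ polyhedron (fun j => linearForm (constraintCoeff G p j)) (constraintBound G p),
      linearForm (fun i => (p.1 i : ℝ) - (b i : ℝ) - 1) z ≤ m G b p := by
  have hgr := isGreatest_m hG h hp
  constructor
  · rw [← M_eq_levelFace]
    obtain ⟨y, hy, hym⟩ := hgr.1
    exact ⟨y, hy, hym⟩
  · rw [← P_eq_polyhedron, ← phi_eq_linearForm]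
    exact fun z hz => hgr.2 (mem_image_of_mem _ hz)

theorem exists_contribution_bounds (hG : G.Nonempty) (h : I G b (Real.exp (-1)) < ⊤)
    {p : (Fin N → ℕ) × ℝ} (hp : p ∈ Gcirc G) :
    ∃ κ : ℝ, 0 < κ ∧ ∀ L : ℝ, 1 ≤ L →
      ENNReal.ofReal (κ⁻¹ * growth G b p L) ≤ contribution G b p L ∧
      contribution G b p L ≤ ENNReal.ofReal (κ * growth G b p L) := by
  have hfin := setLIntegral_exp_phi_lt_top hG h p
  have hvol := (mem_Gcirc.1 hp).2
  rw [phi_eq_linearForm, P_eq_polyhedron] at hfin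
  rw [P_eq_polyhedron] at hvol
  obtain ⟨hne, hmax⟩ := levelFace_nonempty_and_le_m hG h hp
  obtain ⟨κ, hκ, hb⟩ := exists_laplace_bounds hne hmax hvol hfin
  refine ⟨κ, hκ, fun L hL => ?_⟩
  have hgrowth : ∀ x : ℝ, 0 ≤ x → ENNReal.ofReal (x * growth G b p L) =
      ENNReal.ofReal (Real.exp (L * p.2)) * ENNReal.ofReal (x * (Real.exp (L * m G b p) *
        L ^ Module.finrank ℝ (vectorSpan ℝ (levelFace
          (fun j => linearForm (constraintCoeff G p j)) (constraintBound G p)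
          (linearForm fun i => (p.1 i : ℝ) - (b i : ℝ) - 1) (m G b p))))) := fun x hx => by
    rw [← ENNReal.ofReal_mul (Real.exp_pos _).le, growth, d, direction_affineSpan, M_eq_levelFace,
      mul_add, Real.exp_add]
    congr 1
    ring
  have hL' := hb L hL
  rw [Module.finrank_fin_fun] at hL'
  rw [contribution, hgrowth _ hκ.le, hgrowth _ (inv_nonneg.2 hκ.le), phi_eq_linearForm,
    P_eq_polyhedron]
  exact ⟨by gcongr; exact hL'.1, by gcongr; exact hL'.2⟩

/-! ### Comparability of functions near zero -/

theorem comparable_of_exp_neg {f g : ℝ → ℝ} {C : ℝ} (hC : 0 < C)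
    (h : ∀ L, 1 ≤ L → C⁻¹ * g (Real.exp (-L)) ≤ f (Real.exp (-L)) ∧
      f (Real.exp (-L)) ≤ C * g (Real.exp (-L))) : Comparable f g := by
  refine ⟨C, hC, Real.exp (-1), Real.exp_pos _, fun r hr hr1 => ?_⟩
  have hlog : Real.log r < -1 := (Real.log_lt_iff_lt_exp hr).2 hr1
  have := h (-Real.log r) (by linarith)
  rwa [neg_neg, Real.exp_log hr] at this

theorem Comparable.trans {f g k : ℝ → ℝ} (h₁ : Comparable f g) (h₂ : Comparable g k) :
    Comparable f k := by
  obtain ⟨C, hC, δ, hδ, h₁⟩ := h₁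
  obtain ⟨C', hC', δ', hδ', h₂⟩ := h₂
  refine ⟨C * C', by positivity, min δ δ', lt_min hδ hδ', fun r hr hrδ => ?_⟩
  obtain ⟨a1, a2⟩ := h₁ r hr (hrδ.trans_le (min_le_left _ _))
  obtain ⟨b1, b2⟩ := h₂ r hr (hrδ.trans_le (min_le_right _ _))
  constructor
  · calc (C * C')⁻¹ * k r = C⁻¹ * (C'⁻¹ * k r) := by rw [mul_inv, mul_assoc]
      _ ≤ C⁻¹ * g r := by gcongr
      _ ≤ f r := a1
  · calc f r ≤ C * g r := a2
      _ ≤ C * (C' * k r) := by gcongr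
      _ = C * C' * k r := by ring

theorem exp_neg_rpow_mul_abs_log_pow {L : ℝ} (hL : 0 ≤ L) (α : ℝ) (k : ℕ) :
    Real.exp (-L) ^ (-α) * |Real.log (Real.exp (-L))| ^ k = Real.exp (L * α) * L ^ k := by
  rw [← Real.exp_mul, Real.log_exp, abs_neg, abs_of_nonneg hL, neg_mul_neg]

/-- The lexicographic order of the pairs `(α, k)` governs the growth of `exp (L α) L ^ k`. -/
theorem exists_exp_mul_pow_le {α α₀ : ℝ} {k k₀ : ℕ} (h : α < α₀ ∨ α = α₀ ∧ k ≤ k₀) :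
    ∃ K : ℝ, 0 < K ∧ ∀ L : ℝ, 1 ≤ L →
      Real.exp (L * α) * L ^ k ≤ K * (Real.exp (L * α₀) * L ^ k₀) := by
  rcases h with h | ⟨rfl, hk⟩
  · have hε : 0 < α₀ - α := sub_pos.2 h
    refine ⟨k.factorial / (α₀ - α) ^ k, by positivity, fun L hL => ?_⟩
    have hL0 : 0 < L := by linarith
    have h1 := Real.pow_div_factorial_le_exp (L * (α₀ - α)) (by positivity) k
    rw [div_le_iff₀ (by positivity), mul_pow] at h1
    have h2 : (1 : ℝ) ≤ L ^ k₀ := one_le_pow₀ hL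
    have h3 : L ^ k ≤ k.factorial / (α₀ - α) ^ k * Real.exp (L * (α₀ - α)) := by
      rw [div_mul_eq_mul_div, le_div_iff₀ (by positivity)]
      linarith
    calc Real.exp (L * α) * L ^ k
        ≤ Real.exp (L * α) * (k.factorial / (α₀ - α) ^ k * Real.exp (L * (α₀ - α))) := by gcongr
      _ = k.factorial / (α₀ - α) ^ k * (Real.exp (L * α₀) * 1) := by
          rw [show L * α₀ = L * α + L * (α₀ - α) by ring, Real.exp_add]
          ring
      _ ≤ _ := by gcongr
  · refine ⟨1, one_pos, fun L hL => ?_⟩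
    rw [one_mul]
    gcongr

/-! ### The asymptotics of the integral -/

theorem exists_I_growth_bounds (hG : G.Nonempty) (h : ∀ r : ℝ, 0 < r → r < 1 → I G b r < ⊤) :
    ∃ C : ℝ, 0 < C ∧ ∀ L, 1 ≤ L →
      C⁻¹ * ∑ p ∈ Gcirc G, growth G b p L ≤ (I G b (Real.exp (-L))).toReal ∧
      (I G b (Real.exp (-L))).toReal ≤ C * ∑ p ∈ Gcirc G, growth G b p L := by
  have hI1 : I G b (Real.exp (-1)) < ⊤ := h _ (Real.exp_pos _) (by simp)
  have hex : ∀ p : (Fin N → ℕ) × ℝ, ∃ κ : ℝ, 0 < κ ∧ (p ∈ Gcirc G → ∀ L : ℝ, 1 ≤ L →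
      ENNReal.ofReal (κ⁻¹ * growth G b p L) ≤ contribution G b p L ∧
      contribution G b p L ≤ ENNReal.ofReal (κ * growth G b p L)) := fun p => by
    by_cases hp : p ∈ Gcirc G
    · obtain ⟨κ, hκ, hb⟩ := exists_contribution_bounds hG hI1 hp
      exact ⟨κ, hκ, fun _ => hb⟩
    · exact ⟨1, one_pos, fun h => absurd h hp⟩
  choose κ hκ hb using hex
  set n : ℝ := (G.card : ℝ) with hn
  have hn0 : 0 < n := by
    rw [hn]
    exact_mod_cast hG.card_pos
  have hsum : 0 < ∑ p ∈ Gcirc G, κ p := Finset.sum_pos (fun p _ => hκ p) (Gcirc_nonempty hG)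
  set S := ∑ p ∈ Gcirc G, κ p with hS
  refine ⟨S * (1 + n), by positivity, fun L hL => ?_⟩
  have hL0 : 0 < L := by linarith
  have hgr : ∀ p, 0 ≤ growth G b p L := fun p => by
    rw [growth]
    positivity
  have hfin : I G b (Real.exp (-L)) ≠ ⊤ := (h _ (Real.exp_pos _) (by simpa using hL0)).ne
  have hκS : ∀ p ∈ Gcirc G, κ p ≤ S := fun p hp =>
    Finset.single_le_sum (f := κ) (fun q _ => (hκ q).le) hp
  constructor
  · have hterm : ∀ p ∈ Gcirc G,
        growth G b p L ≤ κ p * (n * (I G b (Real.exp (-L))).toReal) := fun p hp => by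
      have h1 := ((hb p hp L hL).1.trans (contribution_le hG p hL0))
      rw [ENNReal.ofReal_le_iff_le_toReal (ENNReal.mul_ne_top (ENNReal.natCast_ne_top _) hfin),
        ENNReal.toReal_mul, ENNReal.toReal_natCast, inv_mul_le_iff₀ (hκ p)] at h1
      exact h1
    have h2 := Finset.sum_le_sum hterm
    rw [← Finset.sum_mul, ← hS] at h2
    rw [inv_mul_le_iff₀ (by positivity)]
    have : 0 ≤ (I G b (Real.exp (-L))).toReal := ENNReal.toReal_nonneg
    refine h2.trans ?_
    rw [← mul_assoc]
    gcongr
    linarith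
  · have h1 : I G b (Real.exp (-L)) ≤ ENNReal.ofReal (∑ p ∈ Gcirc G, κ p * growth G b p L) := by
      rw [ENNReal.ofReal_sum_of_nonneg fun p _ => mul_nonneg (hκ p).le (hgr p)]
      exact (I_le_sum_contribution hG hL0).trans
        (Finset.sum_le_sum fun p hp => (hb p hp L hL).2)
    refine (ENNReal.toReal_le_of_le_ofReal
      (Finset.sum_nonneg fun p _ => mul_nonneg (hκ p).le (hgr p)) h1).trans ?_
    rw [Finset.mul_sum]
    refine Finset.sum_le_sum fun p hp => mul_le_mul_of_nonneg_right ?_ (hgr p)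
    refine (hκS p hp).trans (le_mul_of_one_le_right hsum.le ?_)
    linarith

end MonomialIntegral

theorem proposition4p7 (N : ℕ) (hN : 1 ≤ N) (G : Finset ((Fin N → ℕ) × ℝ))
    (hG : ∀ p ∈ G, 0 ≤ p.2) (b : Fin N → ℕ)
    (hI : ∀ r : ℝ, 0 < r → r < 1 → MonomialIntegral.I G b r < ⊤) :
    -- all the maxima below exist
    (∀ p ∈ MonomialIntegral.Gcirc G,
      IsGreatest (MonomialIntegral.phi b p.1 '' MonomialIntegral.P G p)
        (MonomialIntegral.m G b p)) ∧
    ∃ (α₀ : ℝ) (d₀ : ℕ),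
      IsGreatest {α : ℝ | ∃ p ∈ MonomialIntegral.Gcirc G,
        α = p.2 + MonomialIntegral.m G b p} α₀ ∧
      IsGreatest {k : ℕ | ∃ p ∈ MonomialIntegral.Gcirc G,
        p.2 + MonomialIntegral.m G b p = α₀ ∧ k = MonomialIntegral.d G b p} d₀ ∧
      MonomialIntegral.Comparable
        (fun r => (MonomialIntegral.I G b r).toReal)
        (fun r => ∑ p ∈ MonomialIntegral.Gcirc G,
          r ^ (-p.2 - MonomialIntegral.m G b p) * |Real.log r| ^ MonomialIntegral.d G b p) ∧
      MonomialIntegral.Comparable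
        (fun r => ∑ p ∈ MonomialIntegral.Gcirc G,
          r ^ (-p.2 - MonomialIntegral.m G b p) * |Real.log r| ^ MonomialIntegral.d G b p)
        (fun r => r ^ (-α₀) * |Real.log r| ^ d₀) ∧
      MonomialIntegral.Comparable
        (fun r => (MonomialIntegral.I G b r).toReal)
        (fun r => r ^ (-α₀) * |Real.log r| ^ d₀) ∧
      ((∀ p ∈ G, ∃ k : ℕ, p.2 = (k : ℝ)) → ∃ q : ℚ, α₀ = (q : ℝ)) := by
  have hI1 : MonomialIntegral.I G b (Real.exp (-1)) < ⊤ := hI _ (Real.exp_pos _) (by simp)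
  have hne : G.Nonempty := MonomialIntegral.nonempty_of_I_lt_top hI1
  have hcirc := MonomialIntegral.Gcirc_nonempty hne
  obtain ⟨p₀, hp₀, hα⟩ := (MonomialIntegral.Gcirc G).exists_max_image
    (fun p => p.2 + MonomialIntegral.m G b p) hcirc
  -- Among the pairs of maximal exponent `α₀`, one with a face of maximal dimension.
  obtain ⟨p₁, hp₁, hd⟩ := ((MonomialIntegral.Gcirc G).filter fun p =>
      p.2 + MonomialIntegral.m G b p = p₀.2 + MonomialIntegral.m G b p₀).exists_max_image
    (fun p => MonomialIntegral.d G b p) ⟨p₀, by simp [hp₀]⟩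
  rw [Finset.mem_filter] at hp₁
  set α₀ := p₀.2 + MonomialIntegral.m G b p₀ with hα₀
  set d₀ := MonomialIntegral.d G b p₁ with hd₀
  have hterm : ∀ L : ℝ, 1 ≤ L → ∀ p, Real.exp (-L) ^ (-p.2 - MonomialIntegral.m G b p) *
      |Real.log (Real.exp (-L))| ^ MonomialIntegral.d G b p =
      MonomialIntegral.growth G b p L := fun L hL p => by
    rw [MonomialIntegral.growth, ← MonomialIntegral.exp_neg_rpow_mul_abs_log_pow (by linarith),
      neg_add']
  have hcomp₁ : MonomialIntegral.Comparable
      (fun r => (MonomialIntegral.I G b r).toReal)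
      (fun r => ∑ p ∈ MonomialIntegral.Gcirc G,
        r ^ (-p.2 - MonomialIntegral.m G b p) * |Real.log r| ^ MonomialIntegral.d G b p) := by
    obtain ⟨C, hC, h⟩ := MonomialIntegral.exists_I_growth_bounds hne hI
    refine MonomialIntegral.comparable_of_exp_neg hC fun L hL => ?_
    simp_rw [hterm L hL]
    exact h L hL
  have hcomp₂ : MonomialIntegral.Comparable
      (fun r => ∑ p ∈ MonomialIntegral.Gcirc G,
        r ^ (-p.2 - MonomialIntegral.m G b p) * |Real.log r| ^ MonomialIntegral.d G b p)
      (fun r => r ^ (-α₀) * |Real.log r| ^ d₀) := by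
    have hex : ∀ p : (Fin N → ℕ) × ℝ, ∃ K : ℝ, 0 < K ∧ (p ∈ MonomialIntegral.Gcirc G →
        ∀ L : ℝ, 1 ≤ L →
          MonomialIntegral.growth G b p L ≤ K * (Real.exp (L * α₀) * L ^ d₀)) := fun p => by
      by_cases hp : p ∈ MonomialIntegral.Gcirc G
      · obtain ⟨K, hK, h⟩ := MonomialIntegral.exists_exp_mul_pow_le (k₀ := d₀)
          (k := MonomialIntegral.d G b p) ((hα p hp).lt_or_eq.imp_right fun h =>
            ⟨h, hd p (Finset.mem_filter.2 ⟨hp, h⟩)⟩)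
        exact ⟨K, hK, fun _ => h⟩
      · exact ⟨1, one_pos, fun h => absurd h hp⟩
    choose K hK hle using hex
    have hS : 0 ≤ ∑ p ∈ MonomialIntegral.Gcirc G, K p := Finset.sum_nonneg fun p _ => (hK p).le
    refine MonomialIntegral.comparable_of_exp_neg
      (C := 1 + ∑ p ∈ MonomialIntegral.Gcirc G, K p) (by positivity) fun L hL => ?_
    have hL0 : 0 < L := by linarith
    simp_rw [hterm L hL]
    rw [MonomialIntegral.exp_neg_rpow_mul_abs_log_pow hL0.le]
    have hpos : 0 < Real.exp (L * α₀) * L ^ d₀ := by positivity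
    constructor
    · calc (1 + ∑ p ∈ MonomialIntegral.Gcirc G, K p)⁻¹ * (Real.exp (L * α₀) * L ^ d₀)
          ≤ Real.exp (L * α₀) * L ^ d₀ :=
            mul_le_of_le_one_left hpos.le (inv_le_one_of_one_le₀ (by linarith))
        _ = MonomialIntegral.growth G b p₁ L := by rw [MonomialIntegral.growth, hp₁.2]
        _ ≤ ∑ p ∈ MonomialIntegral.Gcirc G, MonomialIntegral.growth G b p L :=
            Finset.single_le_sum (f := fun p => MonomialIntegral.growth G b p L)
              (fun p _ => by rw [MonomialIntegral.growth]; positivity) hp₁.1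
    · calc ∑ p ∈ MonomialIntegral.Gcirc G, MonomialIntegral.growth G b p L
          ≤ ∑ p ∈ MonomialIntegral.Gcirc G, K p * (Real.exp (L * α₀) * L ^ d₀) :=
            Finset.sum_le_sum fun p hp => hle p hp L hL
        _ = (∑ p ∈ MonomialIntegral.Gcirc G, K p) * (Real.exp (L * α₀) * L ^ d₀) := by
            rw [Finset.sum_mul]
        _ ≤ _ := by
            gcongr
            linarith
  refine ⟨fun p hp => MonomialIntegral.isGreatest_m hne hI1 hp, α₀, d₀, ⟨⟨p₀, hp₀, rfl⟩, ?_⟩,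
    ⟨⟨p₁, hp₁.1, hp₁.2, rfl⟩, ?_⟩, hcomp₁, hcomp₂, hcomp₁.trans hcomp₂, fun hnat => ?_⟩
  · rintro _ ⟨p, hp, rfl⟩
    exact hα p hp
  · rintro _ ⟨p, hp, hpα, rfl⟩
    exact hd p (Finset.mem_filter.2 ⟨hp, hpα⟩)
  · have hp₀G := (MonomialIntegral.mem_Gcirc.1 hp₀).1
    obtain ⟨k, hk⟩ := hnat p₀ hp₀G
    obtain ⟨hface, hmax⟩ := MonomialIntegral.levelFace_nonempty_and_le_m hne hI1 hp₀
    have hA : ∀ j i, ∃ q : ℚ, MonomialIntegral.constraintCoeff G p₀ j i = q := by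
      rintro (j | j) i
      · refine ⟨-(Pi.single j (1 : ℚ) : Fin N → ℚ) i, ?_⟩
        simp only [MonomialIntegral.constraintCoeff, Sum.elim_inl, Pi.neg_apply, Pi.single_apply]
        split_ifs <;> simp
      · exact ⟨(p₀.1 i : ℚ) - j.1.1 i, by simp [MonomialIntegral.constraintCoeff]⟩
    have hc : ∀ j, ∃ q : ℚ, MonomialIntegral.constraintBound G p₀ j = q := by
      rintro (j | j)
      · exact ⟨0, by simp [MonomialIntegral.constraintBound]⟩
      · obtain ⟨l, hl⟩ := hnat j.1 j.2
        exact ⟨l - k, by simp [MonomialIntegral.constraintBound, hl, hk]⟩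
    obtain ⟨q, hq⟩ := exists_rat_eq_of_isMax hA hc
      (fun i => ⟨(p₀.1 i : ℚ) - b i - 1, by simp⟩) hface hmax
    exact ⟨k + q, by rw [hα₀, hk, hq]; push_cast; ring⟩
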